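/- Let $R$ be an arbitrary associative ring with $1$; all modules are unital. For $r\in R$ let $\mathfrak r(r)=\{s\in R: rs=0\}$ be its right annihilator. The ring $R$ is \emph{right P-coherent} if every principal right ideal $rR$ is a finitely presented right $R$-module. A left $R$-module $M$ is \emph{torsion-free} if for all $r\in R$ and $m\in M$, $rm=0$ implies $m\in\mathfrak r(r)M$, where $\mathfrak r(r)M$ is the set of finite sums $\sum_i s_in_i$ with $s_i\in\mathfrak r(r)$, $n_i\in M$. A right $R$-module $M$ is \emph{divisible} if for all $r\in R$ and $m\in M$, $m\,\mathfrak r(r)=0$ implies $m\in Mr$. Let $\mathcal T\!f$ be the class of torsion-free left $R$-modules and $\mathcal Div$ the class of divisible right $R$-modules. For a right $R$-module $M$, its character module $M^*=\mathrm{Hom}_{\mathbb Z}(M,\mathbb Q/\mathbb Z)$ is a left $R$-module via $(rf)(m)=f(mr)$. A \emph{definable subcategory} is a full (isomorphism-closed) subcategory of the category of all left (or all right) $R$-modules that is closed under direct products, direct limits (of directed systems) and pure submodules. A (unary) \emph{pp formula} for left modules is a formula $\varphi(x)$ of the form $\exists y_1\dots y_n\ \bigwedge_{j=1}^k\bigl(a_jx+\sum_{i=1}^n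 b_{ji}y_i=0\bigr)$ with $a_j,b_{ji}\in R$; its elementary dual $\mathrm D\varphi(x)$ is the pp formula for right modules $\exists z_1\dots z_k\ \bigl(x+\sum_j z_ja_j=0\ \wedge\ \bigwedge_{i=1}^n\sum_j z_jb_{ji}=0\bigr)$; pp formulas for right modules and their duals (pp formulas for left modules) are defined symmetrically. A pp implication is a sentence $\forall x(\varphi\to\psi)$ with $\varphi,\psi$ pp formulas. For a class $\mathcal X$ of modules, $\mathrm D\mathcal X$ denotes the class of modules on the other side that satisfy $\forall x(\mathrm D\psi\to\mathrm D\varphi)$ for all pp formulas $\varphi,\psi$ such that $\forall x(\varphi\to\psi)$ is true in every member of $\mathcal X$. \textbf{Theorem.} (1) For every ring $R$ the following are equivalent: (i) $R$ is right P-coherent; (ii) the class $\mathcal T\!f$ is closed under direct products; (iii) the class $\mathcal Div$ is closed under direct limits; (iv) for every right $R$-module $M$, $M$ is divisible if and only if the left $R$-module $M^*$ is torsion-free; (v) $\mathcal T\!f$ is a definable subcategory; (v$'$) $\mathcal T\!f$ is axiomatized by a set of pp implications; (vi) $\mathcal Div$ is a definable subcategory; (vi$'$) $\mathcal Div$ is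 axiomatized by a set of pp implications. (2) If these conditions hold, then $\mathcal Div$ and $\mathcal T\!f$ are elementarily dual, i.e. $\mathrm D\,\mathcal Div=\mathcal T\!f$ and $\mathrm D\,\mathcal T\!f=\mathcal Div$. -/

import Mathlib

/-!
Right `R`-modules are modules over `Rᵐᵒᵖ`: the product `m · r` is `MulOpposite.op r • m`.
Classes of modules (full subcategories) are object properties of the category of modules.
-/

universe u v w

open CategoryTheory

namespace RDMod

section Basic

variable (R : Type u) [Ring R]

/-- A ring is right P-coherent if every principal right ideal `rR` is a finitely presented
right module. -/
def IsRightPCoherent : Prop :=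
  ∀ r : R, Module.FinitePresentation Rᵐᵒᵖ (Submodule.span Rᵐᵒᵖ ({r} : Set R))

/-- A left module `M` is torsion-free if `r m = 0` implies `m ∈ 𝔯(r) M`, where `𝔯(r)` is the
right annihilator of `r` in `R` and `𝔯(r) M` is the additive group of all finite sums of
products `s n` with `s ∈ 𝔯(r)` and `n ∈ M`. -/
def IsTorsionFree (M : Type w) [AddCommGroup M] [Module R M] : Prop :=
  ∀ (r : R) (m : M), r • m = 0 →
    m ∈ AddSubgroup.closure {x : M | ∃ (s : R) (n : M), r * s = 0 ∧ x = s • n}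

/-- A right module `M` is divisible if `m 𝔯(r) = 0` implies `m ∈ M r`, where `𝔯(r)` is the
right annihilator of `r` in `R`. -/
def IsDivisible (M : Type w) [AddCommGroup M] [Module Rᵐᵒᵖ M] : Prop :=
  ∀ (r : R) (m : M), (∀ s : R, r * s = 0 → MulOpposite.op s • m = 0) →
    ∃ n : M, m = MulOpposite.op r • n

/-- The class `𝒯f` of torsion-free left `R`-modules. -/
def Tf : ObjectProperty (ModuleCat.{w} R) := fun M => IsTorsionFree R M

/-- The class `𝒟iv` of divisible right `R`-modules. -/
def Div : ObjectProperty (ModuleCat.{w} Rᵐᵒᵖ) := fun M => IsDivisible R M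

/-- The left `R`-module structure on `Hom_ℤ(M, ℚ/ℤ)` for a right `R`-module `M`, given by
`(r f)(m) = f(m r)`. -/
@[reducible] def characterModuleStructure (M : Type w) [AddCommGroup M] [Module Rᵐᵒᵖ M] :
    Module R (CharacterModule M) where
  smul r f := AddMonoidHom.comp f (DistribSMul.toAddMonoidHom M (MulOpposite.op r))
  one_smul f := CharacterModule.ext M fun m => by
    change f (MulOpposite.op (1 : R) • m) = f m
    simp
  mul_smul r s f := CharacterModule.ext M fun m => by
    change f (MulOpposite.op (r * s) • m) = f (MulOpposite.op s • MulOpposite.op r • m)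
    rw [MulOpposite.op_mul, mul_smul]
  smul_zero _ := rfl
  smul_add _ _ _ := rfl
  add_smul r s f := CharacterModule.ext M fun m => by
    change f (MulOpposite.op (r + s) • m) =
      f (MulOpposite.op r • m) + f (MulOpposite.op s • m)
    rw [MulOpposite.op_add, add_smul, map_add]
  zero_smul f := CharacterModule.ext M fun m => by
    change f (MulOpposite.op (0 : R) • m) = 0
    simp

/-- The character module `M* = Hom_ℤ(M, ℚ/ℤ)` of a right `R`-module, a left `R`-module. -/
def characterModule (M : ModuleCat.{w} Rᵐᵒᵖ) : ModuleCat.{w} R :=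
  letI := characterModuleStructure R M
  ModuleCat.of R (CharacterModule M)

end Basic

section Definable

variable {R : Type u} [Ring R]

/-- The submodule `N` is pure in `M`: every finite system of linear equations with
constants in `N` that is solvable in `M` is solvable in `N`. -/
def IsPure {M : Type w} [AddCommGroup M] [Module R M] (N : Submodule R M) : Prop :=
  ∀ (k n : ℕ) (A : Matrix (Fin k) (Fin n) R) (c : Fin k → N),
    (∃ y : Fin n → M, ∀ j, ∑ i, A j i • y i = (c j : M)) →
      ∃ y : Fin n → N, ∀ j, ∑ i, A j i • y i = c j

/-- Closure under arbitrary direct products. -/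
def ClosedUnderProducts (𝒳 : ObjectProperty (ModuleCat.{w} R)) : Prop :=
  ∀ (ι : Type w) (M : ι → ModuleCat.{w} R),
    (∀ i, 𝒳 (M i)) → 𝒳 (ModuleCat.of R (∀ i, M i))

/-- Closure under direct limits of directed systems. -/
def ClosedUnderDirectLimits (𝒳 : ObjectProperty (ModuleCat.{w} R)) : Prop :=
  ∀ (ι : Type w) [Preorder ι] [IsDirectedOrder ι] [Nonempty ι] [DecidableEq ι]
    (M : ι → ModuleCat.{w} R) (f : ∀ i j, i ≤ j → M i →ₗ[R] M j)
    [DirectedSystem (fun i => M i) (fun i j h => f i j h)],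
    (∀ i, 𝒳 (M i)) → 𝒳 (ModuleCat.of R (Module.DirectLimit (fun i => M i) f))

/-- Closure under pure submodules. -/
def ClosedUnderPureSubmodules (𝒳 : ObjectProperty (ModuleCat.{w} R)) : Prop :=
  ∀ (M : ModuleCat.{w} R) (N : Submodule R M), IsPure N → 𝒳 M → 𝒳 (ModuleCat.of R N)

/-- A definable subcategory: a full subcategory of the category of all modules (closed
under isomorphism) that is closed under direct products, direct limits and pure
submodules. -/
structure IsDefinable (𝒳 : ObjectProperty (ModuleCat.{w} R)) : Prop where
  iso : 𝒳.IsClosedUnderIsomorphisms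
  products : ClosedUnderProducts 𝒳
  directLimits : ClosedUnderDirectLimits 𝒳
  pureSubmodules : ClosedUnderPureSubmodules 𝒳

end Definable

/-- A unary pp formula `φ(x)`, namely
`∃ y₀ … yₙ₋₁, ⋀_{j < k} (a j) x + ∑_{i < n} (B j i) yᵢ = 0`,
for left modules over `R`. Those for right modules are the ones over `Rᵐᵒᵖ`. -/
structure PPFormula (R : Type u) where
  /-- number of quantified variables -/
  n : ℕ
  /-- number of equations -/
  k : ℕ
  /-- coefficients of the free variable -/
  a : Fin k → R
  /-- coefficients of the quantified variables -/
  B : Matrix (Fin k) (Fin n) R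

namespace PPFormula

variable {R : Type u} [Ring R]

/-- The element `x` satisfies the formula `φ` in the module `M`, i.e. `x ∈ φ(M)`. -/
def Sat (φ : PPFormula R) {M : Type w} [AddCommGroup M] [Module R M] (x : M) : Prop :=
  ∃ y : Fin φ.n → M, ∀ j, φ.a j • x + ∑ i, φ.B j i • y i = 0

/-- The pp implication `∀ x (φ → ψ)` is true in the module `M`. -/
def ImpliesIn (φ ψ : PPFormula R) (M : Type w) [AddCommGroup M] [Module R M] : Prop :=
  ∀ x : M, φ.Sat x → ψ.Sat x

/-- `φ ≤_𝒳 ψ`: the implication `∀ x (φ → ψ)` is true in every member of `𝒳`. -/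
def LeOn (𝒳 : ObjectProperty (ModuleCat.{w} R)) (φ ψ : PPFormula R) : Prop :=
  ∀ M : ModuleCat.{w} R, 𝒳 M → φ.ImpliesIn ψ M

/-- The elementary dual of a pp formula for left modules, a formula for right modules: the
dual of `∃ y, ⋀_j (a j) x + ∑_i (B j i) yᵢ = 0` is
`∃ z, x + ∑_j zⱼ (a j) = 0 ∧ ⋀_i ∑_j zⱼ (B j i) = 0`. -/
def dual (φ : PPFormula R) : PPFormula Rᵐᵒᵖ where
  n := φ.k
  k := φ.n + 1
  a := Fin.cons 1 (fun _ => 0)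
  B := Fin.cons (fun j => MulOpposite.op (φ.a j)) (fun i j => MulOpposite.op (φ.B j i))

/-- The elementary dual of a pp formula for right modules, a formula for left modules: the
dual of `∃ y, ⋀_j x (a j) + ∑_i yᵢ (B j i) = 0` is
`∃ z, x + ∑_j (a j) zⱼ = 0 ∧ ⋀_i ∑_j (B j i) zⱼ = 0`. -/
def dualOfRight (φ : PPFormula Rᵐᵒᵖ) : PPFormula R where
  n := φ.k
  k := φ.n + 1
  a := Fin.cons 1 (fun _ => 0)
  B := Fin.cons (fun j => MulOpposite.unop (φ.a j)) (fun i j => MulOpposite.unop (φ.B j i))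

end PPFormula

section Duality

variable {R : Type u} [Ring R]

/-- The class `𝒳` is the class of models of a set of implications of pp formulas. -/
def IsPPAxiomatizable (𝒳 : ObjectProperty (ModuleCat.{w} R)) : Prop :=
  ∃ S : Set (PPFormula R × PPFormula R),
    ∀ M : ModuleCat.{w} R, 𝒳 M ↔ ∀ σ ∈ S, σ.1.ImpliesIn σ.2 M

/-- The elementary dual of a class of left modules: the class of right modules axiomatized
by the implications `∀ x (Dψ → Dφ)` for all `φ`, `ψ` with `φ ≤_𝒳 ψ`. -/
def dualClass (𝒳 : ObjectProperty (ModuleCat.{w} R)) :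
    ObjectProperty (ModuleCat.{w} Rᵐᵒᵖ) :=
  fun M => ∀ φ ψ : PPFormula R, PPFormula.LeOn 𝒳 φ ψ → ψ.dual.ImpliesIn φ.dual M

/-- The elementary dual of a class of right modules: the class of left modules axiomatized
by the implications `∀ x (Dψ → Dφ)` for all `φ`, `ψ` with `φ ≤_𝒳 ψ`. -/
def dualClassOfRight (𝒳 : ObjectProperty (ModuleCat.{w} Rᵐᵒᵖ)) :
    ObjectProperty (ModuleCat.{w} R) :=
  fun M => ∀ φ ψ : PPFormula Rᵐᵒᵖ, PPFormula.LeOn 𝒳 φ ψ →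
    ψ.dualOfRight.ImpliesIn φ.dualOfRight M

end Duality

end RDMod

/-! Since `rR ≅ R/𝔯(r)`, right P-coherence says that every `𝔯(r)` is a finitely generated right
ideal. Given generators `sᵢ`, torsion-freeness becomes the pp implications `r x = 0 → ∃ y, x = ∑ sᵢ
yᵢ`, and divisibility becomes `⋀ x sᵢ = 0 → ∃ y, x = y r`. The two are elementary duals for each
`r`, and classes of models of pp implications are definable.

Duality passes through characters: a character of `M` satisfies `φ` iff it kills the solutions of
`Dφ` in `M` (`PPFormula.sat_character_iff`). So a pp implication holds in `M*` iff its dual holds in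
`M`, which gives (iv) and (2).

Conversely, each closure condition is tested on one object built from `𝔯(r)`: a power of `R` for
products, a directed system of powers of `R*` for limits, a direct sum of copies of `R*` for
characters. A tautological element of it forces finite generation of `𝔯(r)`. -/

namespace RDMod

/-! ### Extending and separating characters -/

section Characters

/-- A character of `A` that vanishes on the kernel of `g : A → B` factors through `g`. -/
theorem exists_character_comp_eq {A : Type*} {B : Type*} [AddCommGroup A] [AddCommGroup B]
    (g : A →+ B) (c : CharacterModule A) (h : ∀ a, g a = 0 → c a = 0) :
    ∃ d : CharacterModule B, ∀ a, d (g a) = c a := by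
  have hinj : Function.Injective (QuotientAddGroup.kerLift g) :=
    QuotientAddGroup.kerLift_injective g
  let c' : A →+ AddCircle (1 : ℚ) := c
  let c₁ : CharacterModule (A ⧸ g.ker) := QuotientAddGroup.lift g.ker c' fun a ha => h a ha
  -- Injectivity of `ℚ/ℤ` extends the induced character along `A / ker g ↪ B`.
  obtain ⟨d, hd⟩ := CharacterModule.dual_surjective_of_injective
    (QuotientAddGroup.kerLift g).toIntLinearMap hinj c₁
  exact ⟨d, fun a => DFunLike.congr_fun hd (QuotientAddGroup.mk a)⟩

/-- Characters separate points from subgroups. -/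
theorem exists_character_of_notMem {A : Type*} [AddCommGroup A] (H : AddSubgroup A) {x : A}
    (hx : x ∉ H) : ∃ c : CharacterModule A, (∀ h ∈ H, c h = 0) ∧ c x ≠ 0 := by
  have hx' : (QuotientAddGroup.mk x : A ⧸ H) ≠ 0 := by
    rwa [Ne, QuotientAddGroup.eq_zero_iff]
  obtain ⟨d, hd⟩ := CharacterModule.exists_character_apply_ne_zero_of_ne_zero hx'
  let d' : (A ⧸ H) →+ AddCircle (1 : ℚ) := d
  refine ⟨d'.comp (QuotientAddGroup.mk' H), fun h hh => ?_, hd⟩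
  change d (QuotientAddGroup.mk h : A ⧸ H) = 0
  rw [(QuotientAddGroup.eq_zero_iff h).2 hh, map_zero]

/-- The right `R`-module structure on `Hom_ℤ(M, ℚ/ℤ)` for a left `R`-module `M`, given by
`(f r)(m) = f(r m)`. -/
@[reducible] def rightCharacterModuleStructure (R : Type u) [Ring R] (M : Type w)
    [AddCommGroup M] [Module R M] : Module Rᵐᵒᵖ (CharacterModule M) where
  smul r f := AddMonoidHom.comp f (DistribSMul.toAddMonoidHom M r.unop)
  one_smul f := CharacterModule.ext M fun m => by
    change f ((1 : R) • m) = f m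
    simp
  mul_smul r s f := CharacterModule.ext M fun m => by
    change f ((s.unop * r.unop) • m) = f (s.unop • r.unop • m)
    rw [mul_smul]
  smul_zero _ := rfl
  smul_add _ _ _ := rfl
  add_smul r s f := CharacterModule.ext M fun m => by
    change f ((r.unop + s.unop) • m) = f (r.unop • m) + f (s.unop • m)
    rw [add_smul, map_add]
  zero_smul f := CharacterModule.ext M fun m => by
    change f ((0 : R) • m) = 0
    simp

attribute [local instance] characterModuleStructure rightCharacterModuleStructure

theorem smul_character_apply {R : Type u} [Ring R] {M : Type w} [AddCommGroup M]
    [Module Rᵐᵒᵖ M] (r : R) (f : CharacterModule M) (m : M) :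
    (r • f) m = f (MulOpposite.op r • m) := rfl

theorem op_smul_character_apply {R : Type u} [Ring R] {M : Type w} [AddCommGroup M]
    [Module R M] (r : Rᵐᵒᵖ) (f : CharacterModule M) (m : M) :
    (r • f) m = f (r.unop • m) := rfl

theorem character_add_apply {M : Type w} [AddCommGroup M] (f g : CharacterModule M) (m : M) :
    (f + g) m = f m + g m := rfl

theorem character_zero_apply {M : Type w} [AddCommGroup M] (m : M) :
    (0 : CharacterModule M) m = 0 := rfl

theorem character_sum_apply {M : Type w} [AddCommGroup M] {ι : Type*} (s : Finset ι)
    (f : ι → CharacterModule M) (m : M) : (∑ i ∈ s, f i) m = ∑ i ∈ s, f i m := by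
  let ev : CharacterModule M →+ AddCircle (1 : ℚ) :=
    { toFun := fun c => c m, map_zero' := rfl, map_add' := fun _ _ => rfl }
  exact map_sum ev f s

end Characters

/-! ### Elementary duality of pp formulas via characters -/

namespace PPFormula

section Dual

variable {A : Type u} {B : Type u} [Ring A] {M : Type w} [AddCommGroup M] [Module A M]

/-- The solution set of the dual of `φ`, with the scalars transported along `e`. -/
def dualSet (e : B → A) (φ : PPFormula B) (M : Type w) [AddCommGroup M] [Module A M] :
    AddSubgroup M where
  carrier := {x | ∃ z : Fin φ.k → M,
    x + ∑ j, e (φ.a j) • z j = 0 ∧ ∀ i, ∑ j, e (φ.B j i) • z j = 0}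
  zero_mem' := ⟨0, by simp⟩
  add_mem' := by
    rintro x x' ⟨z, hz, hz'⟩ ⟨t, ht, ht'⟩
    refine ⟨z + t, ?_, fun i => ?_⟩
    · simp only [Pi.add_apply, smul_add, Finset.sum_add_distrib]
      rw [add_add_add_comm, hz, ht, add_zero]
    · simp only [Pi.add_apply, smul_add, Finset.sum_add_distrib, hz', ht', add_zero]
  neg_mem' := by
    rintro x ⟨z, hz, hz'⟩
    refine ⟨-z, ?_, fun i => ?_⟩
    · simp only [Pi.neg_apply, smul_neg, Finset.sum_neg_distrib]
      rw [← neg_add, hz, neg_zero]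
    · simp only [Pi.neg_apply, smul_neg, Finset.sum_neg_distrib, hz', neg_zero]

theorem mem_dualSet {e : B → A} {φ : PPFormula B} {x : M} :
    x ∈ φ.dualSet e M ↔ ∃ z : Fin φ.k → M,
      x + ∑ j, e (φ.a j) • z j = 0 ∧ ∀ i, ∑ j, e (φ.B j i) • z j = 0 := Iff.rfl

variable [Ring B] [Module B (CharacterModule M)] {e : B → A}

/-- A character satisfies `φ` if and only if it vanishes on the solutions of the dual of `φ`. -/
theorem sat_character_iff (h : ∀ (b : B) (c : CharacterModule M) (m : M), (b • c) m = c (e b • m))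
    (φ : PPFormula B) (c : CharacterModule M) :
    φ.Sat c ↔ ∀ x ∈ φ.dualSet e M, c x = 0 := by
  constructor
  · rintro ⟨y, hy⟩ x ⟨z, hz, hz'⟩
    -- The `j`-th equation is evaluated at `z j`; after summing over `j` the terms in `y` vanish by
    -- `hz'`.
    have h₁ : ∀ j, c (e (φ.a j) • z j) + ∑ i, y i (e (φ.B j i) • z j) = 0 := fun j => by
      have := DFunLike.congr_fun (hy j) (z j)
      simpa only [character_add_apply, character_sum_apply, h, character_zero_apply] using this
    have h₂ : ∑ j, ∑ i, y i (e (φ.B j i) • z j) = 0 := by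
      rw [Finset.sum_comm]
      refine Finset.sum_eq_zero fun i _ => ?_
      rw [← map_sum, hz', map_zero]
    have h₃ : c (∑ j, e (φ.a j) • z j) = 0 := by
      have := Finset.sum_eq_zero fun j (_ : j ∈ Finset.univ) => h₁ j
      rwa [Finset.sum_add_distrib, h₂, add_zero, ← map_sum] at this
    have h₄ := congrArg c hz
    rwa [map_add, h₃, add_zero, map_zero] at h₄
  · intro hc
    let α : (Fin φ.k → M) →+ M :=
      { toFun := fun z => ∑ j, e (φ.a j) • z j
        map_zero' := by simp
        map_add' := fun z t => by
          simp only [Pi.add_apply, smul_add, Finset.sum_add_distrib] }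
    let β : (Fin φ.k → M) →+ (Fin φ.n → M) :=
      { toFun := fun z i => ∑ j, e (φ.B j i) • z j
        map_zero' := by ext; simp
        map_add' := fun z t => by
          ext
          simp only [Pi.add_apply, smul_add, Finset.sum_add_distrib] }
    let c' : M →+ AddCircle (1 : ℚ) := c
    obtain ⟨d, hd⟩ := exists_character_comp_eq β (c'.comp α) fun z hz => by
      have := hc (-α z) ⟨z, neg_add_cancel _, fun i => congrFun hz i⟩
      rw [map_neg, neg_eq_zero] at this
      exact this
    let d' : (Fin φ.n → M) →+ AddCircle (1 : ℚ) := d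
    have hd' : ∀ z, d' (β z) = c (α z) := hd
    let y : Fin φ.n → CharacterModule M := fun i =>
      -(d'.comp (AddMonoidHom.single (fun _ => M) i) : M →+ AddCircle (1 : ℚ))
    have hy : ∀ i m, y i m = -d' (Pi.single i m) := fun _ _ => rfl
    refine ⟨y, fun j => CharacterModule.ext M fun m => ?_⟩
    have hα : α (Pi.single j m) = e (φ.a j) • m := by
      change ∑ j', e (φ.a j') • (Pi.single j m : Fin φ.k → M) j' = _
      rw [Finset.sum_eq_single j] <;> simp +contextual
    have hβ : β (Pi.single j m) = ∑ i, Pi.single i (e (φ.B j i) • m) := by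
      rw [Finset.univ_sum_single]
      funext i
      change ∑ j', e (φ.B j' i) • (Pi.single j m : Fin φ.k → M) j' = _
      rw [Finset.sum_eq_single j] <;> simp +contextual
    have key := hd' (Pi.single j m)
    rw [hα, hβ, map_sum] at key
    rw [character_add_apply, character_sum_apply, h, character_zero_apply, ← key,
      ← Finset.sum_add_distrib]
    refine Finset.sum_eq_zero fun i _ => ?_
    rw [h, hy, add_neg_cancel]

/-- A pp implication holds in the character module of `M` if and only if the dual implication
holds in `M`. -/
theorem impliesIn_character_iff
    (h : ∀ (b : B) (c : CharacterModule M) (m : M), (b • c) m = c (e b • m))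
    (φ ψ : PPFormula B) :
    φ.ImpliesIn ψ (CharacterModule M) ↔ ψ.dualSet e M ≤ φ.dualSet e M := by
  constructor
  · intro H x hx
    by_contra hx'
    obtain ⟨c, hc, hcx⟩ := exists_character_of_notMem _ hx'
    exact hcx ((sat_character_iff h ψ c).1 (H c ((sat_character_iff h φ c).2 hc)) x hx)
  · intro H c hc
    rw [sat_character_iff h] at hc ⊢
    exact fun x hx => hc x (H hx)

end Dual

section DualFormula

variable {R : Type u} [Ring R] {M : Type w} [AddCommGroup M]

/-- The parameter `e` of `dualSet` is `op` here and `unop` below, so that one argument covers both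
sides. -/
theorem sat_dual_iff [Module Rᵐᵒᵖ M] (φ : PPFormula R) (x : M) :
    φ.dual.Sat x ↔ x ∈ φ.dualSet MulOpposite.op M := by
  refine exists_congr fun z => Fin.forall_fin_succ.trans ?_
  simp [dual]
  rfl

theorem sat_dualOfRight_iff [Module R M] (φ : PPFormula Rᵐᵒᵖ) (x : M) :
    φ.dualOfRight.Sat x ↔ x ∈ φ.dualSet MulOpposite.unop M := by
  refine exists_congr fun z => Fin.forall_fin_succ.trans ?_
  simp [dualOfRight]
  rfl

attribute [local instance] characterModuleStructure rightCharacterModuleStructure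

theorem impliesIn_characterModule_iff [Module Rᵐᵒᵖ M] (φ ψ : PPFormula R) :
    φ.ImpliesIn ψ (CharacterModule M) ↔ ψ.dual.ImpliesIn φ.dual M := by
  rw [impliesIn_character_iff (e := MulOpposite.op) smul_character_apply]
  simp only [ImpliesIn, sat_dual_iff]
  rfl

theorem impliesIn_rightCharacterModule_iff [Module R M] (φ ψ : PPFormula Rᵐᵒᵖ) :
    φ.ImpliesIn ψ (CharacterModule M) ↔ ψ.dualOfRight.ImpliesIn φ.dualOfRight M := by
  rw [impliesIn_character_iff (e := MulOpposite.unop) op_smul_character_apply]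
  simp only [ImpliesIn, sat_dualOfRight_iff]
  rfl

end DualFormula

section Basic

variable {R : Type u} [Ring R] {M : Type w} [AddCommGroup M] [Module R M]

/-- The formula `⋀ i, s i x = 0`. -/
def annihilated {n : ℕ} (s : Fin n → R) : PPFormula R where
  n := 0
  k := n
  a := s
  B := fun _ => Fin.elim0

/-- The formula `∃ y, x + ∑ i, s i y i = 0`. -/
def combination {n : ℕ} (s : Fin n → R) : PPFormula R where
  n := n
  k := 1
  a := fun _ => 1
  B := fun _ => s

theorem sat_annihilated {n : ℕ} (s : Fin n → R) (x : M) :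
    (annihilated s).Sat x ↔ ∀ i, s i • x = 0 := by
  simp [Sat, annihilated]

theorem sat_combination {n : ℕ} (s : Fin n → R) (x : M) :
    (combination s).Sat x ↔ ∃ y : Fin n → M, x = ∑ i, s i • y i := by
  constructor
  · rintro ⟨y, hy⟩
    have h : (1 : R) • x + ∑ i, s i • y i = 0 := hy (0 : Fin 1)
    refine ⟨fun i => -y i, ?_⟩
    simpa [eq_neg_iff_add_eq_zero] using h
  · rintro ⟨y, rfl⟩
    refine ⟨fun i => -y i, fun j => ?_⟩
    change (1 : R) • _ + ∑ i, s i • -y i = 0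
    simp

/-- Duality exchanges `annihilated` and `combination`; this is what pairs torsion-freeness with
divisibility. -/
theorem mem_dualSet_annihilated {B : Type u} {e : B → R} {n : ℕ} (s : Fin n → B)
    (x : M) : x ∈ (annihilated s).dualSet e M ↔ ∃ y : Fin n → M, x = ∑ i, e (s i) • y i := by
  constructor
  · rintro ⟨z, hz, -⟩
    have h : x + ∑ i, e (s i) • z i = 0 := hz
    refine ⟨fun i => -z i, ?_⟩
    simpa [eq_neg_iff_add_eq_zero] using h
  · rintro ⟨z, rfl⟩
    refine ⟨fun i => -z i, ?_, fun i => i.elim0⟩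
    change _ + ∑ i, e (s i) • -z i = 0
    simp

theorem mem_dualSet_combination {B : Type u} [Ring B] {e : B → R} (he : e 1 = 1) {n : ℕ}
    (s : Fin n → B) (x : M) :
    x ∈ (combination s).dualSet e M ↔ ∀ i, e (s i) • x = 0 := by
  constructor
  · rintro ⟨z, hz, hz'⟩ i
    have h₁ : x + ∑ _j : Fin 1, e 1 • z _j = 0 := hz
    have h₂ : ∑ _j : Fin 1, e (s i) • z _j = 0 := hz' i
    rw [Fin.sum_univ_one] at h₁ h₂
    rw [he, one_smul, ← eq_neg_iff_add_eq_zero] at h₁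
    rw [h₁, smul_neg, h₂, neg_zero]
  · intro h
    refine ⟨fun _ => -x, ?_, fun i => ?_⟩
    · change x + ∑ _j : Fin 1, e 1 • -x = 0
      simp [he]
    · change ∑ _j : Fin 1, e (s i) • -x = 0
      simp [h i]

theorem Sat.map {φ : PPFormula R} {x : M} (hx : φ.Sat x) {N : Type*} [AddCommGroup N]
    [Module R N] (f : M →ₗ[R] N) : φ.Sat (f x) := by
  obtain ⟨y, hy⟩ := hx
  refine ⟨fun i => f (y i), fun j => ?_⟩
  simpa using congrArg f (hy j)

theorem sat_pi_iff {ι : Type*} {N : ι → Type*} [∀ i, AddCommGroup (N i)] [∀ i, Module R (N i)]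
    (φ : PPFormula R) (x : ∀ i, N i) : φ.Sat x ↔ ∀ i, φ.Sat (x i) := by
  refine ⟨fun hx i => hx.map (LinearMap.proj i), fun hx => ?_⟩
  choose y hy using hx
  refine ⟨fun l i => y i l, fun j => ?_⟩
  funext i
  simpa using hy i j

theorem Sat.of_isPure {φ : PPFormula R} {N : Submodule R M} (hN : IsPure N) {x : N}
    (hx : φ.Sat (x : M)) : φ.Sat x := by
  obtain ⟨y, hy⟩ := hx
  obtain ⟨t, ht⟩ := hN φ.k φ.n φ.B (fun j => -(φ.a j • x))
    ⟨y, fun j => by simpa [eq_neg_iff_add_eq_zero, add_comm] using hy j⟩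
  exact ⟨t, fun j => by rw [ht, add_neg_cancel]⟩

end Basic

section DirectLimit

variable {R : Type u} [Ring R] {ι : Type*} [Preorder ι] [IsDirectedOrder ι] [Nonempty ι]
  [DecidableEq ι] {M : ι → Type*} [∀ i, AddCommGroup (M i)] [∀ i, Module R (M i)]
  {f : ∀ i j, i ≤ j → M i →ₗ[R] M j} [DirectedSystem M (fun i j h => f i j h)]

/-- A pp formula satisfied in a direct limit is satisfied at some stage. -/
theorem exists_sat_of_directLimit (φ : PPFormula R) (x : Module.DirectLimit M f)
    (hx : φ.Sat x) : ∃ (i : ι) (t : M i), Module.DirectLimit.of R ι M f i t = x ∧ φ.Sat t := by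
  obtain ⟨y, hy⟩ := hx
  obtain ⟨i₀, x₀, rfl⟩ := Module.DirectLimit.exists_of x
  choose iy ty hty using fun l => Module.DirectLimit.exists_of (y l)
  -- The finitely many witnesses move to a common stage, and then to a later one where the finitely
  -- many equations hold.
  obtain ⟨i₁, hi₁⟩ := Finite.exists_le iy
  obtain ⟨i, hi₀, hi⟩ := exists_ge_ge i₀ i₁
  let x' := f i₀ i hi₀ x₀
  let y' := fun l => f (iy l) i ((hi₁ l).trans hi) (ty l)
  have hzero : ∀ j, Module.DirectLimit.of R ι M f i (φ.a j • x' + ∑ l, φ.B j l • y' l) = 0 := by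
    intro j
    rw [← hy j]
    simp [x', y', Module.DirectLimit.of_f, hty]
  choose k hik hk using fun j => Module.DirectLimit.of.zero_exact (hzero j)
  obtain ⟨k₀, hk₀⟩ := Finite.exists_le k
  obtain ⟨m, hm, him⟩ := exists_ge_ge k₀ i
  refine ⟨m, f i m him x', by simp [x', Module.DirectLimit.of_f], fun l => f i m him (y' l),
    fun j => ?_⟩
  have := congrArg (f (k j) m ((hk₀ j).trans hm)) (hk j)
  rw [map_zero, Module.DirectedSystem.map_map f] at this
  simpa using this

end DirectLimit

end PPFormula

/-- The class of models of a set of pp implications is a definable subcategory. -/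
theorem IsPPAxiomatizable.isDefinable {R : Type u} [Ring R] {𝒳 : ObjectProperty (ModuleCat.{w} R)}
    (h : IsPPAxiomatizable 𝒳) : IsDefinable 𝒳 := by
  obtain ⟨S, hS⟩ := h
  refine ⟨⟨fun {M N} i hM => ?_⟩, fun ι M hM => ?_, fun ι _ _ _ _ M f _ hM => ?_,
    fun M N hN hM => ?_⟩
  · rw [hS] at hM ⊢
    intro σ hσ x hx
    simpa using (hM σ hσ _ (hx.map i.toLinearEquiv.symm.toLinearMap)).map
      i.toLinearEquiv.toLinearMap
  · rw [hS]
    intro σ hσ x hx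
    exact (PPFormula.sat_pi_iff _ _).2 fun i =>
      (hS _).1 (hM i) σ hσ _ ((PPFormula.sat_pi_iff σ.1 x).1 hx i)
  · rw [hS]
    intro σ hσ x hx
    obtain ⟨i, t, rfl, ht⟩ := PPFormula.exists_sat_of_directLimit σ.1 x hx
    exact ((hS _).1 (hM i) σ hσ t ht).map (Module.DirectLimit.of R ι (fun i => M i) f i)
  · rw [hS] at hM ⊢
    intro σ hσ x hx
    exact (hM σ hσ _ (hx.map N.subtype)).of_isPure hN

end RDMod

/-! ### P-coherence as finite generation of right annihilators -/

namespace RDMod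

section Coherent

variable {R : Type u} [Ring R]

/-- Left multiplication by `r`, as an endomorphism of the right module `R`. -/
def leftMul (r : R) : R →ₗ[Rᵐᵒᵖ] R where
  toFun t := r * t
  map_add' := mul_add r
  map_smul' s t := by simp [MulOpposite.smul_eq_mul_unop, mul_assoc]

theorem mem_ker_leftMul {r t : R} : t ∈ LinearMap.ker (leftMul r) ↔ r * t = 0 := Iff.rfl

/-- The right module `R` is free of rank one. -/
def opEquivSelf (R : Type u) [Ring R] : Rᵐᵒᵖ ≃ₗ[Rᵐᵒᵖ] R where
  toFun := MulOpposite.unop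
  invFun := MulOpposite.op
  left_inv _ := rfl
  right_inv _ := rfl
  map_add' _ _ := rfl
  map_smul' s t := by simp [MulOpposite.smul_eq_mul_unop]

/-- `rR` is the image of the finitely presented module `R` under left multiplication by `r`, so it
is finitely presented iff the kernel `𝔯(r)` is finitely generated. -/
theorem isRightPCoherent_iff_fg :
    IsRightPCoherent R ↔ ∀ r : R, (LinearMap.ker (leftMul r)).FG := by
  have : Module.FinitePresentation Rᵐᵒᵖ R := .of_equiv (opEquivSelf R)
  refine forall_congr' fun r => ?_
  have hr : Submodule.span Rᵐᵒᵖ ({r} : Set R) = LinearMap.range (leftMul r) := by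
    ext x
    rw [Submodule.mem_span_singleton, LinearMap.mem_range]
    exact ⟨fun ⟨t, ht⟩ => ⟨t.unop, ht⟩, fun ⟨t, ht⟩ => ⟨MulOpposite.op t, ht⟩⟩
  rw [hr, ← Module.FinitePresentation.fg_ker_iff _ (leftMul r).surjective_rangeRestrict,
    LinearMap.ker_rangeRestrict]

theorem isRightPCoherent_iff_exists_generators :
    IsRightPCoherent R ↔ ∀ r : R, ∃ (n : ℕ) (s : Fin n → R), (∀ i, r * s i = 0) ∧
      ∀ t, r * t = 0 → ∃ u : Fin n → R, t = ∑ i, s i * u i := by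
  rw [isRightPCoherent_iff_fg]
  refine forall_congr' fun r => ?_
  rw [Submodule.fg_iff_exists_fin_generating_family]
  refine exists_congr fun n => exists_congr fun s => ?_
  have hspan : ∀ t, t ∈ Submodule.span Rᵐᵒᵖ (Set.range s) ↔
      ∃ u : Fin n → R, t = ∑ i, s i * u i := by
    intro t
    rw [Submodule.mem_span_range_iff_exists_fun]
    exact ⟨fun ⟨c, hc⟩ => ⟨fun i => (c i).unop, hc.symm⟩,
      fun ⟨c, hc⟩ => ⟨fun i => MulOpposite.op (c i), hc.symm⟩⟩
  constructor
  · intro h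
    refine ⟨fun i => ?_, fun t ht => ?_⟩
    · rw [← mem_ker_leftMul, ← h]
      exact Submodule.subset_span ⟨i, rfl⟩
    · rwa [← hspan, h, mem_ker_leftMul]
  · rintro ⟨h, h'⟩
    refine le_antisymm (Submodule.span_le.2 ?_) fun t ht => (hspan t).2 (h' t ht)
    rintro _ ⟨i, rfl⟩
    exact h i

/-- `R` is right P-coherent as soon as, for every `r`, the characters of `R` do not distinguish
the right annihilator of `r` from the right ideal generated by a finite part of it. -/
theorem IsRightPCoherent.of_characters
    (h : ∀ r : R, ∃ F : Finset R, (∀ s ∈ F, r * s = 0) ∧ ∀ s, r * s = 0 →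
      ∀ c : CharacterModule R, (∀ t ∈ F, ∀ u, c (t * u) = 0) → c s = 0) :
    IsRightPCoherent R := by
  rw [isRightPCoherent_iff_fg]
  intro r
  obtain ⟨F, hF, hc⟩ := h r
  refine ⟨F, le_antisymm (Submodule.span_le.2 hF) fun s hs => ?_⟩
  by_contra hs'
  obtain ⟨c, hc₁, hc₂⟩ := exists_character_of_notMem
    (Submodule.span Rᵐᵒᵖ (F : Set R)).toAddSubgroup hs'
  exact hc₂ (hc s hs c fun t ht u => hc₁ _ <|
    Submodule.smul_mem _ (MulOpposite.op u) (Submodule.subset_span ht))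

end Coherent

attribute [local instance] characterModuleStructure rightCharacterModuleStructure

/-! ### Pp axioms for the two classes -/

section Classes

variable {R : Type u} [Ring R] {M : Type w} [AddCommGroup M]

/-- The first components of the list are the candidate generators of `𝔯(r)` in the converse
arguments. -/
theorem exists_list_of_mem_closure [Module R M] {r : R} {x : M}
    (hx : x ∈ AddSubgroup.closure {x : M | ∃ (s : R) (n : M), r * s = 0 ∧ x = s • n}) :
    ∃ l : List (R × M), (∀ p ∈ l, r * p.1 = 0) ∧ x = (l.map fun p => p.1 • p.2).sum := by
  induction hx using AddSubgroup.closure_induction with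
  | mem x hx =>
    obtain ⟨s, n, hs, rfl⟩ := hx
    exact ⟨[(s, n)], by simpa using hs, by simp⟩
  | zero => exact ⟨[], by simp, by simp⟩
  | add x y _ _ hx hy =>
    obtain ⟨l, hl, rfl⟩ := hx
    obtain ⟨l', hl', rfl⟩ := hy
    exact ⟨l ++ l', fun p hp => (List.mem_append.1 hp).elim (hl p) (hl' p), by simp⟩
  | neg x _ hx =>
    obtain ⟨l, hl, rfl⟩ := hx
    refine ⟨l.map fun p => (p.1, -p.2), fun p hp => ?_, ?_⟩
    · obtain ⟨q, hq, rfl⟩ := List.mem_map.1 hp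
      exact hl q hq
    · simp [List.sum_neg, Function.comp_def]

/-- If `s` generates the right annihilator of `r`, then `𝔯(r) M` consists of the combinations of
`s` with coefficients in `M`. -/
theorem mem_closure_iff_of_generators [Module R M] {r : R} {n : ℕ} {s : Fin n → R}
    (hs : ∀ i, r * s i = 0) (hs' : ∀ t, r * t = 0 → ∃ u : Fin n → R, t = ∑ i, s i * u i) (x : M) :
    x ∈ AddSubgroup.closure {x : M | ∃ (s : R) (n : M), r * s = 0 ∧ x = s • n} ↔
      ∃ y : Fin n → M, x = ∑ i, s i • y i := by
  constructor
  · intro hx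
    induction hx using AddSubgroup.closure_induction with
    | mem x hx =>
      obtain ⟨t, m, ht, rfl⟩ := hx
      obtain ⟨u, rfl⟩ := hs' t ht
      exact ⟨fun i => u i • m, by simp [Finset.sum_smul, mul_smul]⟩
    | zero => exact ⟨0, by simp⟩
    | add x y _ _ hx hy =>
      obtain ⟨z, rfl⟩ := hx
      obtain ⟨z', rfl⟩ := hy
      exact ⟨z + z', by simp [Finset.sum_add_distrib]⟩
    | neg x _ hx =>
      obtain ⟨z, rfl⟩ := hx
      exact ⟨-z, by simp⟩
  · rintro ⟨y, rfl⟩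
    exact sum_mem fun i _ => AddSubgroup.subset_closure ⟨s i, y i, hs i, rfl⟩

variable {n : R → ℕ} {s : ∀ r, Fin (n r) → R} (hs : ∀ r i, r * s r i = 0)
  (hs' : ∀ r t, r * t = 0 → ∃ u : Fin (n r) → R, t = ∑ i, s r i * u i)

include hs hs'

/-- Finiteness of the generating family makes `𝔯(r) M` the solution set of a single pp formula. -/
theorem isTorsionFree_iff_impliesIn [Module R M] :
    IsTorsionFree R M ↔ ∀ r : R, (PPFormula.annihilated (fun _ : Fin 1 => r)).ImpliesIn
      (PPFormula.combination (s r)) M := by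
  refine forall_congr' fun r => forall_congr' fun x => ?_
  rw [mem_closure_iff_of_generators (hs r) (hs' r), PPFormula.sat_annihilated,
    PPFormula.sat_combination]
  simp

theorem isDivisible_iff_impliesIn [Module Rᵐᵒᵖ M] :
    IsDivisible R M ↔ ∀ r : R,
      (PPFormula.annihilated (fun i => MulOpposite.op (s r i))).ImpliesIn
        (PPFormula.combination (fun _ : Fin 1 => MulOpposite.op r)) M := by
  refine forall_congr' fun r => forall_congr' fun x => ?_
  rw [PPFormula.sat_annihilated, PPFormula.sat_combination]
  refine imp_congr ⟨fun h i => h _ (hs r i), fun h t ht => ?_⟩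
    ⟨fun ⟨m, hm⟩ => ⟨fun _ => m, by simpa using hm⟩, fun ⟨y, hy⟩ => ⟨y 0, by simpa using hy⟩⟩
  obtain ⟨u, rfl⟩ := hs' r t ht
  simp [Finset.sum_smul, mul_smul, h]

theorem isTorsionFree_character_iff_of_generators [Module Rᵐᵒᵖ M] :
    IsTorsionFree R (CharacterModule M) ↔ IsDivisible R M := by
  rw [isTorsionFree_iff_impliesIn hs hs', isDivisible_iff_impliesIn hs hs']
  refine forall_congr' fun r => ?_
  rw [PPFormula.impliesIn_character_iff (e := MulOpposite.op) smul_character_apply]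
  refine forall_congr' fun x => ?_
  rw [PPFormula.mem_dualSet_combination rfl, PPFormula.mem_dualSet_annihilated,
    PPFormula.sat_annihilated, PPFormula.sat_combination]

theorem isDivisible_character_iff_of_generators [Module R M] :
    IsDivisible R (CharacterModule M) ↔ IsTorsionFree R M := by
  rw [isTorsionFree_iff_impliesIn hs hs', isDivisible_iff_impliesIn hs hs']
  refine forall_congr' fun r => ?_
  rw [PPFormula.impliesIn_character_iff (e := MulOpposite.unop) op_smul_character_apply]
  refine forall_congr' fun x => ?_
  rw [PPFormula.mem_dualSet_combination rfl, PPFormula.mem_dualSet_annihilated,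
    PPFormula.sat_annihilated, PPFormula.sat_combination]
  rfl

end Classes

/-! ### Consequences of P-coherence -/

section Coherent

variable {R : Type u} [Ring R]

theorem IsRightPCoherent.isTorsionFree_character_iff (h : IsRightPCoherent R) {M : Type w}
    [AddCommGroup M] [Module Rᵐᵒᵖ M] :
    IsTorsionFree R (CharacterModule M) ↔ IsDivisible R M := by
  choose n s hs hs' using isRightPCoherent_iff_exists_generators.1 h
  exact isTorsionFree_character_iff_of_generators hs hs'

theorem IsRightPCoherent.isDivisible_character_iff (h : IsRightPCoherent R) {M : Type w}
    [AddCommGroup M] [Module R M] :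
    IsDivisible R (CharacterModule M) ↔ IsTorsionFree R M := by
  choose n s hs hs' using isRightPCoherent_iff_exists_generators.1 h
  exact isDivisible_character_iff_of_generators hs hs'

theorem IsRightPCoherent.isPPAxiomatizable_tf (h : IsRightPCoherent R) :
    IsPPAxiomatizable (Tf.{u, w} R) := by
  choose n s hs hs' using isRightPCoherent_iff_exists_generators.1 h
  refine ⟨Set.range fun r => (PPFormula.annihilated (fun _ : Fin 1 => r),
    PPFormula.combination (s r)), fun M => ?_⟩
  rw [Set.forall_mem_range]
  exact isTorsionFree_iff_impliesIn hs hs'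

theorem IsRightPCoherent.isPPAxiomatizable_div (h : IsRightPCoherent R) :
    IsPPAxiomatizable (Div.{u, w} R) := by
  choose n s hs hs' using isRightPCoherent_iff_exists_generators.1 h
  refine ⟨Set.range fun r => (PPFormula.annihilated (fun i => MulOpposite.op (s r i)),
    PPFormula.combination (fun _ : Fin 1 => MulOpposite.op r)), fun M => ?_⟩
  rw [Set.forall_mem_range]
  exact isDivisible_iff_impliesIn hs hs'

/-- The axioms of `Div` are among the implications true on `Div`, so a member `M` of the dual class
has divisible `M*` and is torsion-free. Conversely, if `M` is torsion-free then `M*` lies in `Div`,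
and every implication true there dualizes to `M`. -/
theorem IsRightPCoherent.dualClassOfRight_div (h : IsRightPCoherent R) :
    dualClassOfRight (Div.{u, w} R) = Tf.{u, w} R := by
  ext M
  constructor
  · intro hM
    choose n s hs hs' using isRightPCoherent_iff_exists_generators.1 h
    change IsTorsionFree R M
    rw [← isDivisible_character_iff_of_generators hs hs', isDivisible_iff_impliesIn hs hs']
    intro r
    rw [PPFormula.impliesIn_rightCharacterModule_iff]
    exact hM _ _ fun N hN => (isDivisible_iff_impliesIn hs hs').1 hN r
  · intro hM φ ψ hφψ
    rw [← PPFormula.impliesIn_rightCharacterModule_iff]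
    exact hφψ (ModuleCat.of Rᵐᵒᵖ (CharacterModule M)) (h.isDivisible_character_iff.2 hM)

theorem IsRightPCoherent.dualClass_tf (h : IsRightPCoherent R) :
    dualClass (Tf.{u, w} R) = Div.{u, w} R := by
  ext M
  constructor
  · intro hM
    choose n s hs hs' using isRightPCoherent_iff_exists_generators.1 h
    change IsDivisible R M
    rw [← isTorsionFree_character_iff_of_generators hs hs', isTorsionFree_iff_impliesIn hs hs']
    intro r
    rw [PPFormula.impliesIn_characterModule_iff]
    exact hM _ _ fun N hN => (isTorsionFree_iff_impliesIn hs hs').1 hN r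
  · intro hM φ ψ hφψ
    rw [← PPFormula.impliesIn_characterModule_iff]
    exact hφψ (ModuleCat.of R (CharacterModule M)) (h.isTorsionFree_character_iff.2 hM)

end Coherent

/-! ### Recovering P-coherence from the closure conditions -/

section Converse

variable {R : Type u} [Ring R]

/-- In the power of `R` indexed by `𝔯(r)`, the tautological family `(s)ₛ` is killed by `r`, hence is
a finite sum `∑ tⱼ nⱼ` with `tⱼ ∈ 𝔯(r)`. Reading off coordinate `s` shows that the `tⱼ` generate. -/
theorem IsRightPCoherent.of_closedUnderProducts
    (h : ClosedUnderProducts (Tf.{u, max u v} R)) : IsRightPCoherent R := by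
  classical
  rw [isRightPCoherent_iff_fg]
  intro r
  have key := h (ULift.{v} {s : R // r * s = 0}) (fun _ => ModuleCat.of R (ULift.{max u v} R))
    fun _ t m hm => AddSubgroup.subset_closure
      ⟨m.down, ULift.up 1, congrArg ULift.down hm, ULift.ext _ _ (mul_one _).symm⟩
  obtain ⟨l, hl, hx⟩ := exists_list_of_mem_closure <|
    key r (fun s => ULift.up s.down.1) (funext fun s => ULift.ext _ _ s.down.2)
  refine ⟨(l.map Prod.fst).toFinset, le_antisymm (Submodule.span_le.2 ?_) fun s hs => ?_⟩
  · intro t ht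
    obtain ⟨p, hp, rfl⟩ := List.mem_map.1 (List.mem_toFinset.1 ht)
    exact hl p hp
  · let ev : (∀ _ : ULift.{v} {s : R // r * s = 0}, ULift.{max u v} R) →+ R :=
      { toFun := fun y => (y ⟨s, hs⟩).down, map_zero' := rfl, map_add' := fun _ _ => rfl }
    have hs₁ : s = (l.map fun p => p.1 * ev p.2).sum := by
      have := (congrArg ev hx).trans (map_list_sum ev _)
      rw [List.map_map] at this
      exact this
    rw [hs₁]
    refine list_sum_mem fun t ht => ?_
    obtain ⟨p, hp, rfl⟩ := List.mem_map.1 ht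
    exact Submodule.smul_mem _ (MulOpposite.op (ev p.2))
      (Submodule.subset_span (List.mem_toFinset.2 (List.mem_map_of_mem hp)))

/-- The character module of the left module `R` is divisible. -/
theorem isDivisible_character_self (R : Type u) [Ring R] : IsDivisible R (CharacterModule R) := by
  intro r c hc
  -- `c` kills `𝔯(r)`, the kernel of left multiplication by `r`, so it factors through that map.
  obtain ⟨d, hd⟩ := exists_character_comp_eq (AddMonoidHom.mulLeft r) c fun s hs => by
    have := DFunLike.congr_fun (hc s hs) 1
    rwa [op_smul_character_apply, MulOpposite.unop_op, smul_eq_mul, mul_one] at this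
  exact ⟨d, CharacterModule.ext R fun t => (hd t).symm⟩

/-- On the direct sum of copies of `R*` indexed by `𝔯(r)`, let `f` evaluate the summand at `s` in
`s`. Then `r f = 0`, so `f = ∑ tⱼ gⱼ` with `tⱼ ∈ 𝔯(r)`. If `c` kills every `tⱼ R`, then `c tⱼ = 0`,
and evaluating at `c` in summand `s` gives `c(s) = 0`. -/
theorem IsRightPCoherent.of_isTorsionFree_character
    (h : ∀ M : ModuleCat.{max u v} Rᵐᵒᵖ, IsDivisible R M → IsTorsionFree R (characterModule R M)) :
    IsRightPCoherent R := by
  classical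
  refine .of_characters fun r => ?_
  let ι := ULift.{v} {s : R // r * s = 0}
  let M := ι →₀ CharacterModule R
  have hM : IsDivisible R M := by
    intro t m hm
    choose d hd using fun i => isDivisible_character_self R t (m i)
      fun u hu => DFunLike.congr_fun (hm u hu) i
    -- Zero is chosen outside the support of `m`, to keep the quotient finitely supported.
    refine ⟨Finsupp.onFinset m.support (fun i => if m i = 0 then 0 else d i) (by aesop), ?_⟩
    ext1 i
    rw [Finsupp.smul_apply, Finsupp.onFinset_apply]
    split_ifs with hi
    · rw [hi, smul_zero]
    · exact hd i
  let f : CharacterModule M := Finsupp.liftAddHom fun i : ι =>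
    ({ toFun := fun c => c i.down.1, map_zero' := rfl, map_add' := fun _ _ => rfl } :
      CharacterModule R →+ AddCircle (1 : ℚ))
  have hf : ∀ i c, f (Finsupp.single i c) = c i.down.1 := fun i c =>
    Finsupp.liftAddHom_apply_single _ i c
  have hrf : r • f = 0 := by
    refine Finsupp.addHom_ext (M := CharacterModule R) (f := r • f) (g := 0) fun i c => ?_
    change f (MulOpposite.op r • Finsupp.single i c) = 0
    rw [Finsupp.smul_single, hf, op_smul_character_apply, MulOpposite.unop_op, smul_eq_mul,
      i.down.2, map_zero]
  have hTf : IsTorsionFree R (CharacterModule M) := h (ModuleCat.of Rᵐᵒᵖ M) hM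
  obtain ⟨l, hl, hlf⟩ := exists_list_of_mem_closure (hTf r f hrf)
  refine ⟨(l.map Prod.fst).toFinset, fun t ht => ?_, fun s hs c hc => ?_⟩
  · obtain ⟨p, hp, rfl⟩ := List.mem_map.1 (List.mem_toFinset.1 ht)
    exact hl p hp
  · let x : M := Finsupp.single ⟨s, hs⟩ c
    let ev : CharacterModule M →+ AddCircle (1 : ℚ) :=
      { toFun := fun g => g x, map_zero' := rfl, map_add' := fun _ _ => rfl }
    have hx : c s = (l.map fun p => ev (p.1 • p.2)).sum := by
      have := (congrArg ev hlf).trans (map_list_sum ev _)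
      rw [List.map_map] at this
      exact (hf ⟨s, hs⟩ c).symm.trans this
    rw [hx]
    refine List.sum_eq_zero fun a ha => ?_
    obtain ⟨p, hp, rfl⟩ := List.mem_map.1 ha
    have hpc : MulOpposite.op p.1 • c = 0 := CharacterModule.ext R fun u =>
      hc p.1 (List.mem_toFinset.2 (List.mem_map_of_mem hp)) u
    change p.2 (MulOpposite.op p.1 • Finsupp.single _ c) = 0
    rw [Finsupp.smul_single, hpc, Finsupp.single_zero, map_zero]

/-- For finite `F ⊆ 𝔯(r)`, `X F` is the set of characters killing `F R`, and `x F` is its inclusion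
into `R*`, an element of the power `M F`. In the limit the class of `x` is killed by `𝔯(r)`, hence
divisible by `r`. This already holds at some stage `G`, where every character killing `G R` is a
multiple by `r` and so kills `𝔯(r)`. -/
theorem IsRightPCoherent.of_closedUnderDirectLimits
    (h : ClosedUnderDirectLimits (Div.{u, max u v} R)) : IsRightPCoherent R := by
  classical
  refine .of_characters fun r => ?_
  let ι := Finset (ULift.{v} {s : R // r * s = 0})
  let X : ι → Type (max u v) := fun F =>
    ULift.{v} {c : CharacterModule R // ∀ s ∈ F, ∀ t, c (s.down.1 * t) = 0}
  let incl : ∀ F G : ι, F ≤ G → X G → X F := fun F G hFG c =>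
    ⟨c.down.1, fun s hs => c.down.2 s (hFG hs)⟩
  let M : ι → ModuleCat.{max u v} Rᵐᵒᵖ := fun F => ModuleCat.of Rᵐᵒᵖ (X F → CharacterModule R)
  let f : ∀ F G, F ≤ G → M F →ₗ[Rᵐᵒᵖ] M G := fun F G hFG =>
    LinearMap.funLeft Rᵐᵒᵖ (CharacterModule R) (incl F G hFG)
  have : DirectedSystem (fun F => M F) (fun F G hFG => f F G hFG) :=
    ⟨fun _ _ => rfl, fun _ _ _ _ _ _ => rfl⟩
  have hM : ∀ F, Div.{u, max u v} R (M F) := by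
    intro F t m hm
    choose d hd using fun c => isDivisible_character_self R t (m c)
      fun u hu => congrFun (hm u hu) c
    exact ⟨d, funext hd⟩
  have hlim := h ι M f hM
  let x : ∀ F, M F := fun F c => c.down.1
  have hxf : ∀ F G hFG, f F G hFG (x F) = x G := fun _ _ _ => rfl
  let of := Module.DirectLimit.of Rᵐᵒᵖ ι (fun F => M F) f
  have hx : ∀ F G, of F (x F) = of G (x G) := by
    intro F G
    have hof : ∀ F G (hFG : F ≤ G), of F (x F) = of G (x G) := fun F G hFG => by
      rw [← hxf F G hFG]
      exact (Module.DirectLimit.of_f (f := f) (hij := hFG)).symm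
    exact (hof F (F ∪ G) Finset.subset_union_left).trans
      (hof G (F ∪ G) Finset.subset_union_right).symm
  obtain ⟨y, hy⟩ := hlim r (of ∅ (x ∅)) fun s hs => by
    -- The class of `x` does not depend on the stage, and at stage `{s}` it is visibly killed by
    -- `s`.
    rw [hx ∅ {⟨s, hs⟩}, ← map_smul]
    have : MulOpposite.op s • x {⟨s, hs⟩} = 0 := funext fun c => CharacterModule.ext R fun t =>
      c.down.2 _ (Finset.mem_singleton_self _) t
    rw [this, map_zero]
  obtain ⟨F, y, rfl⟩ := Module.DirectLimit.exists_of y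
  have hF : of F (x F - MulOpposite.op r • y) = 0 := by
    rw [map_sub, map_smul, hx F ∅, hy]
    exact sub_self _
  obtain ⟨G, hFG, hG⟩ := Module.DirectLimit.of.zero_exact hF
  rw [map_sub, map_smul, hxf F G hFG, sub_eq_zero] at hG
  refine ⟨G.image fun s => s.down.1, fun t ht => ?_, fun s hs c hc => ?_⟩
  · obtain ⟨s, -, rfl⟩ := Finset.mem_image.1 ht
    exact s.down.2
  · let c' : X G := ⟨c, fun t ht => hc _ (Finset.mem_image_of_mem _ ht)⟩
    have : c = MulOpposite.op r • f F G hFG y c' := congrFun hG c'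
    rw [this, op_smul_character_apply, MulOpposite.unop_op, smul_eq_mul, hs, map_zero]

end Converse

end RDMod

/-! ### The equivalences and the duality -/

theorem mainTheorem3 (R : Type u) [Ring R] :
    List.TFAE [
      RDMod.IsRightPCoherent R,
      RDMod.ClosedUnderProducts (RDMod.Tf.{u, max u v} R),
      RDMod.ClosedUnderDirectLimits (RDMod.Div.{u, max u v} R),
      ∀ M : ModuleCat.{max u v} Rᵐᵒᵖ,
        RDMod.IsDivisible R M ↔ RDMod.IsTorsionFree R (RDMod.characterModule R M),
      RDMod.IsDefinable (RDMod.Tf.{u, max u v} R),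
      RDMod.IsPPAxiomatizable (RDMod.Tf.{u, max u v} R),
      RDMod.IsDefinable (RDMod.Div.{u, max u v} R),
      RDMod.IsPPAxiomatizable (RDMod.Div.{u, max u v} R)] ∧
    (RDMod.IsRightPCoherent R →
      RDMod.dualClassOfRight (RDMod.Div.{u, max u v} R) = RDMod.Tf.{u, max u v} R ∧
      RDMod.dualClass (RDMod.Tf.{u, max u v} R) = RDMod.Div.{u, max u v} R) := by
  refine ⟨?_, fun h => ⟨h.dualClassOfRight_div, h.dualClass_tf⟩⟩
  tfae_have 1 → 6 := fun h => h.isPPAxiomatizable_tf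
  tfae_have 6 → 5 := fun h => h.isDefinable
  tfae_have 5 → 2 := fun h => h.products
  tfae_have 2 → 1 := RDMod.IsRightPCoherent.of_closedUnderProducts
  tfae_have 1 → 8 := fun h => h.isPPAxiomatizable_div
  tfae_have 8 → 7 := fun h => h.isDefinable
  tfae_have 7 → 3 := fun h => h.directLimits
  tfae_have 3 → 1 := RDMod.IsRightPCoherent.of_closedUnderDirectLimits
  tfae_have 1 → 4 := fun h M => h.isTorsionFree_character_iff.symm
  tfae_have 4 → 1 := fun h =>
    RDMod.IsRightPCoherent.of_isTorsionFree_character fun M => (h M).1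
  tfae_finish
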